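/- Consider two asynchronous processes that communicate through atomic read/write registers, each performing one $\mathrm{TAS}()$ call. Each process alternates between private coin flips and shared-memory steps (a read or a write of one register), starting with a coin flip, until its call returns a bit; a process whose call has returned only performs no-ops when scheduled. The outcomes of the coin flips (the $i$-th flip among all processes returns $\omega_i$) are i.i.d. from an arbitrary fixed distribution $\mathcal D$ on a countable set $\Omega$. An adversary maps each finite execution to the process taking the next step; it is oblivious if its choice depends only on the length of the execution (counting no-ops), that is, if it fixes the schedule in advance. A randomized 2-process TAS implementation is such an algorithm $M$ all of whose executions, for all schedules and all coin flip outcomes, are linearizable with respect to the test-and-set object (a bit, initially $0$; $\mathrm{TAS}()$ sets the bit and returns its previous value). **Theorem.** For every randomized 2-process TAS implementation $M$ and every integer $t\ge 0$ there is an oblivious adversary $A$ such that, in the random execution of $M$ scheduled by $A$, with probability at least $1/4^t$ the max-step complexity $\max_p T_p$ is at least $t$, where $T_p$ is the number of shared-memory steps that process $p$ takes during its $\mathrm{TAS}()$ call; that is, $$\Pr_{\omega\sim\mathcal D^\infty}\bigl[\text{some process takes at least } t \text{ shared-memory steps}\bigr]\ \ge\ \frac1{4^t}.$$ -/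

import Mathlib

open MeasureTheory
open scoped ENNReal

namespace TwoProcessTAS

/-- An atomic shared-memory access of a process: either a read of register `r`, where `k v` is what
the process does next if the value read is `v`, or a write of `v` to register `r`, where `k` is what
the process does next. -/
inductive Access (Reg Val Next : Type*)
  | read (r : Reg) (k : Val → Next)
  | write (r : Reg) (v : Val) (k : Next)

/-- A randomized one-shot algorithm for two processes (with IDs `0`, `1`), each of which performs a
single `TAS()` call. Coin flips take values in `Ω`, registers are indexed by `Reg` and
hold values in `Val`. Every process alternates between coin flips and shared-memory accesses, and
its first step is a coin flip: `F` is the type of local states in which the next step is a coin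
flip, `O` the type of local states in which it is a shared-memory access.
After any step a process may finish its call, returning a bit (`false` is `0`, `true` is `1`). -/
structure Algorithm (Ω Reg Val F O : Type*) where
  /-- initial contents of the registers -/
  memInit : Reg → Val
  /-- initial local states -/
  start : Fin 2 → F
  /-- what a process does after a coin flip with the given outcome -/
  flip : Fin 2 → F → Ω → O ⊕ Bool
  /-- the shared-memory access that a process performs, and what it does afterwards -/
  access : Fin 2 → O → Access Reg Val (F ⊕ Bool)

/-- The local state of a process. -/
inductive Local (F O : Type*)
  | flipping (f : F)
  | accessing (o : O)
  | finished (b : Bool)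

/-- Local state after a coin flip. -/
def Local.afterFlip {F O : Type*} : O ⊕ Bool → Local F O
  | .inl o => .accessing o
  | .inr b => .finished b

/-- Local state after a shared-memory access. -/
def Local.afterAccess {F O : Type*} : F ⊕ Bool → Local F O
  | .inl f => .flipping f
  | .inr b => .finished b

/-- The return value of the call, once it has finished. -/
def Local.result {F O : Type*} : Local F O → Option Bool
  | .finished b => some b
  | _ => none

/-- What happens in a step. A process that has finished performs only `noop`s. -/
inductive StepKind (Ω Reg Val : Type*)
  | flip (x : Ω)
  | read (r : Reg) (v : Val)
  | write (r : Reg) (v : Val)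
  | noop

/-- Reads and writes are the shared-memory steps. -/
def StepKind.isAccess {Ω Reg Val : Type*} : StepKind Ω Reg Val → Bool
  | .read _ _ => true
  | .write _ _ => true
  | _ => false

/-- One element of an execution: the process taking the step, what happens in the step, and the
response of the process's `TAS()` call if the call finishes with this step. -/
structure Step (Ω Reg Val : Type*) where
  pid : Fin 2
  kind : StepKind Ω Reg Val
  resp : Option Bool

/-- A configuration: register contents, local states, total number of coin flips so far. -/
structure Config (Reg Val F O : Type*) where
  mem : Reg → Val
  loc : Fin 2 → Local F O
  flips : ℕ

section Executions

variable {Ω Reg Val F O : Type*} [DecidableEq Reg]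

/-- The initial configuration. -/
def Algorithm.initConfig (M : Algorithm Ω Reg Val F O) : Config Reg Val F O where
  mem := M.memInit
  loc := fun p => .flipping (M.start p)
  flips := 0

/-- The next step of process `p` in configuration `c`. The outcomes of the coin flips are given by
`ω`: the `i`-th coin flip among all processes (counted from `0`) returns `ω i`. -/
def Algorithm.step (M : Algorithm Ω Reg Val F O) (ω : ℕ → Ω) (c : Config Reg Val F O)
    (p : Fin 2) : Config Reg Val F O × Step Ω Reg Val :=
  match c.loc p with
  | .flipping f =>
      let l : Local F O := .afterFlip (M.flip p f (ω c.flips))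
      (⟨c.mem, Function.update c.loc p l, c.flips + 1⟩, ⟨p, .flip (ω c.flips), l.result⟩)
  | .accessing o =>
      match M.access p o with
      | .read r k =>
          let l : Local F O := .afterAccess (k (c.mem r))
          (⟨c.mem, Function.update c.loc p l, c.flips⟩, ⟨p, .read r (c.mem r), l.result⟩)
      | .write r v k =>
          let l : Local F O := .afterAccess k
          (⟨Function.update c.mem r v, Function.update c.loc p l, c.flips⟩,
            ⟨p, .write r v, l.result⟩)
  | .finished _ => (c, ⟨p, .noop, none⟩)

/-- The execution from configuration `c` in which processes take steps in the order given by a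
finite schedule. -/
def Algorithm.execFrom (M : Algorithm Ω Reg Val F O) (ω : ℕ → Ω) :
    Config Reg Val F O → List (Fin 2) → List (Step Ω Reg Val)
  | _, [] => []
  | c, p :: σ => (M.step ω c p).2 :: M.execFrom ω (M.step ω c p).1 σ

/-- The execution determined by a finite schedule and a coin flip vector. -/
def Algorithm.exec (M : Algorithm Ω Reg Val F O) (σ : List (Fin 2)) (ω : ℕ → Ω) :
    List (Step Ω Reg Val) :=
  M.execFrom ω M.initConfig σ

end Executions

section Linearizability

variable {Ω Reg Val : Type*}

/-- The `TAS()` call of `p` is invoked at position `i`, the position of the first step of `p`. -/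
def InvokedAt (E : List (Step Ω Reg Val)) (p : Fin 2) (i : ℕ) : Prop :=
  (∃ e, E[i]? = some e ∧ e.pid = p) ∧ ∀ j < i, ∀ e, E[j]? = some e → e.pid ≠ p

/-- The `TAS()` call of `p` responds with return value `b` at position `i`. -/
def RespondsAt (E : List (Step Ω Reg Val)) (p : Fin 2) (b : Bool) (i : ℕ) : Prop :=
  ∃ e, E[i]? = some e ∧ e.pid = p ∧ e.resp = some b

/-- The sequential test-and-set object: the calls of the processes in the list are executed
one after the other, starting with stored bit `s`. Each call sets the bit and returns its previous
value; the result lists each call with its return value. -/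
def seqTAS : Bool → List (Fin 2) → List (Fin 2 × Bool)
  | _, [] => []
  | s, p :: l => (p, s) :: seqTAS true l

/-- A finite execution is linearizable with respect to the (one-shot) test-and-set object with
initial bit `0`: there is a sequential order `l` of all completed calls and possibly some pending
ones (the remaining pending calls are dropped), such that every completed call returns
the value it returns in the sequential execution, and the order respects real-time precedence. -/
def Linearizable (E : List (Step Ω Reg Val)) : Prop :=
  ∃ l : List (Fin 2), l.Nodup ∧
    (∀ p ∈ l, ∃ i, InvokedAt E p i) ∧
    (∀ p b i, RespondsAt E p b i → (p, b) ∈ seqTAS false l) ∧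
    (∀ p q b i j, RespondsAt E p b i → InvokedAt E q j → i < j → q ∈ l →
      List.Sublist [p, q] l)

end Linearizability

/-- `M` is an implementation of a 2-process test-and-set object: every execution of `M`, under any
schedule and any coin flip outcomes, is linearizable. -/
def Algorithm.IsTAS {Ω Reg Val F O : Type*} [DecidableEq Reg]
    (M : Algorithm Ω Reg Val F O) : Prop :=
  ∀ (σ : List (Fin 2)) (ω : ℕ → Ω), Linearizable (M.exec σ ω)

/-- An adversary maps a finite execution to the process that takes the next step. -/
abbrev Adversary (Ω Reg Val : Type*) := List (Step Ω Reg Val) → Fin 2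

/-- An oblivious adversary is a function of just the length of the past execution. -/
def Adversary.IsOblivious {Ω Reg Val : Type*} (A : Adversary Ω Reg Val) : Prop :=
  ∀ E E' : List (Step Ω Reg Val), E.length = E'.length → A E = A E'

section Complexity

variable {Ω Reg Val F O : Type*} [DecidableEq Reg]

/-- The first `n` elements of the schedule determined by `M`, `A` and the coin flips. -/
def Algorithm.sched (M : Algorithm Ω Reg Val F O) (A : Adversary Ω Reg Val) (ω : ℕ → Ω) :
    ℕ → List (Fin 2)
  | 0 => []
  | n + 1 => M.sched A ω n ++ [A (M.exec (M.sched A ω n) ω)]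

/-- The number of shared-memory steps that process `p` takes in a finite execution. -/
def accessCount (p : Fin 2) (E : List (Step Ω Reg Val)) : ℕ :=
  E.countP fun e => e.pid = p && e.kind.isAccess

/-- The max-step complexity of the infinite execution of `M` scheduled by `A` with coin flips `ω`:
the maximum over the processes of the (possibly infinite) number of shared-memory steps taken. -/
noncomputable def Algorithm.maxStep (M : Algorithm Ω Reg Val F O) (A : Adversary Ω Reg Val)
    (ω : ℕ → Ω) : ℕ∞ :=
  ⨆ p : Fin 2, ⨆ n : ℕ, (accessCount p (M.exec (M.sched A ω n) ω) : ℕ∞)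

end Complexity

end TwoProcessTAS

/-!
Fix, for each of the two processes, the entire sequence of its coin flips. If a coin flip and the
access that follows it are taken as a single step, a block, then `M` becomes a deterministic
protocol, in which a process that returns decides on the winner, the process that obtains `0`.
By linearizability all decisions agree, and a process running alone decides on itself, so that the
solo runs from the initial state do not lead to the same decision. As in the impossibility proofs
for consensus, this property of a state passes to one of its proper extensions. Hence there is a
schedule of `2 * t` blocks after which nobody has decided; every block has contributed an access,
so some process has made at least `t` of them.

This schedule depends on the coin flips, but there are only `4 ^ t` schedules of `2 * t` blocks.
Once one of them is fixed, the global index of each coin flip of each process is determined, so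
that reading off the global coin flips from independent per-process sequences yields `D^∞`. Hence
one of the schedules works with probability at least `1 / 4 ^ t`.
-/

namespace TwoProcessTAS

section Protocol

/-- A global state of a shared-memory system: the register contents and the local states of the
processes. -/
structure SharedState (ι Reg Val L : Type*) where
  mem : Reg → Val
  loc : ι → L

/-- A deterministic protocol over atomic read/write registers. A step of process `p` in local state
`l` is either a local transition or a shared-memory access, as given by `act p l`. The process has
decided on `v` once `out p l = some v`; it then takes no further action. -/
structure Protocol (ι Reg Val L V : Type*) where
  act : ι → L → L ⊕ Access Reg Val L
  out : ι → L → Option V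
  act_of_out : ∀ {p l v}, out p l = some v → act p l = .inl l

namespace Protocol

variable {ι Reg Val L V : Type*} [DecidableEq ι] [DecidableEq Reg]
variable {P : Protocol ι Reg Val L V} {s s' : SharedState ι Reg Val L} {p q : ι} {v w : V}

/-- The effect on `s` of the action `x` of process `p`. -/
def perform (s : SharedState ι Reg Val L) (p : ι) : L ⊕ Access Reg Val L → SharedState ι Reg Val L
  | .inl l => ⟨s.mem, Function.update s.loc p l⟩
  | .inr (.read r k) => ⟨s.mem, Function.update s.loc p (k (s.mem r))⟩
  | .inr (.write r v l) => ⟨Function.update s.mem r v, Function.update s.loc p l⟩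

variable (P) in
/-- The state after a step of process `p`. -/
def step (s : SharedState ι Reg Val L) (p : ι) : SharedState ι Reg Val L :=
  perform s p (P.act p (s.loc p))

variable (P) in
/-- The state reached under the finite schedule `σ`. -/
def run (s : SharedState ι Reg Val L) (σ : List ι) : SharedState ι Reg Val L :=
  σ.foldl P.step s

variable (P) in
/-- Some process has decided on `v`. -/
def Decided (s : SharedState ι Reg Val L) (v : V) : Prop :=
  ∃ p, P.out p (s.loc p) = some v

variable (P) in
/-- Under no schedule starting in `s` do two processes decide on different values. -/
def Agreement (s : SharedState ι Reg Val L) : Prop :=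
  ∀ σ v w, P.Decided (P.run s σ) v → P.Decided (P.run s σ) w → v = w

variable (P) in
/-- The solo run of `p` from `s` reaches a state in which some process has decided on `v`. -/
def SoloDecides (p : ι) (s : SharedState ι Reg Val L) (v : V) : Prop :=
  ∃ n, P.Decided (P.run s (List.replicate n p)) v

variable (P) in
/-- All solo runs from `s` lead to the same decision. Its negation plays the role of bivalence in
impossibility proofs for consensus. -/
def SoloAgree (s : SharedState ι Reg Val L) : Prop :=
  ∃ v, ∀ p, P.SoloDecides p s v

variable (P) in
/-- Under the schedule `σ`, every step is by a process that has not decided yet. -/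
def Active (s : SharedState ι Reg Val L) (σ : List ι) : Prop :=
  ∀ τ p, τ ++ [p] <+: σ → P.out p ((P.run s τ).loc p) = none

/-- The registers and the local state of `p` agree in `s` and `s'`, so that `p`, running alone,
cannot distinguish the two states. -/
def Indist (p : ι) (s s' : SharedState ι Reg Val L) : Prop :=
  s.mem = s'.mem ∧ s.loc p = s'.loc p

theorem run_append (σ τ : List ι) : P.run s (σ ++ τ) = P.run (P.run s σ) τ :=
  List.foldl_append

theorem run_concat (σ : List ι) : P.run s (σ ++ [p]) = P.step (P.run s σ) p :=
  run_append σ [p]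

theorem perform_loc_of_ne (h : q ≠ p) (x : L ⊕ Access Reg Val L) :
    (perform s p x).loc q = s.loc q := by
  rcases x with _ | _ | _ <;> exact Function.update_of_ne h ..

theorem step_loc_of_ne (h : q ≠ p) : (P.step s p).loc q = s.loc q :=
  perform_loc_of_ne h _

theorem run_replicate_loc_of_ne (h : q ≠ p) (n : ℕ) :
    (P.run s (List.replicate n p)).loc q = s.loc q := by
  induction n generalizing s with
  | zero => rfl
  | succ _ ih => exact ih.trans (step_loc_of_ne h)

theorem step_of_out_eq_some (h : P.out p (s.loc p) = some v) : P.step s p = s := by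
  simp [step, perform, P.act_of_out h]

theorem Indist.step (h : Indist p s s') : Indist p (P.step s p) (P.step s' p) := by
  obtain ⟨hmem, hloc⟩ := h
  unfold Protocol.step
  rw [← hloc]
  rcases P.act p (s.loc p) with l | ⟨r, k⟩ | ⟨r, v, l⟩ <;> simp [Indist, perform, hmem]

theorem Indist.run_replicate (h : Indist p s s') (n : ℕ) :
    Indist p (P.run s (List.replicate n p)) (P.run s' (List.replicate n p)) := by
  induction n generalizing s s' with
  | zero => exact h
  | succ _ ih => exact ih h.step

/-- A read is invisible to the other process, and of two writes to the same register only the later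
one is visible. -/
theorem step_comm_or_indist (s : SharedState ι Reg Val L) (h : p ≠ q) :
    P.step (P.step s p) q = P.step (P.step s q) p ∨
      Indist q (P.step s q) (P.step (P.step s p) q) ∨
      Indist p (P.step s p) (P.step (P.step s q) p) := by
  have hq : P.step (P.step s p) q = perform (P.step s p) q (P.act q (s.loc q)) := by
    rw [step, step_loc_of_ne h.symm]
  have hp : P.step (P.step s q) p = perform (P.step s q) p (P.act p (s.loc p)) := by
    rw [step, step_loc_of_ne h]
  rw [hq, hp]
  unfold step
  rcases P.act p (s.loc p) with l | ⟨r, k⟩ | ⟨r, v, l⟩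
  case inl | inr.read =>
    right; left
    rcases P.act q (s.loc q) with l' | ⟨r', k'⟩ | ⟨r', v', l'⟩ <;> simp [Indist, perform]
  rcases P.act q (s.loc q) with l' | ⟨r', k'⟩ | ⟨r', v', l'⟩
  case inl | inr.read =>
    right; right; simp [Indist, perform]
  by_cases hr : r = r'
  · right; left; simp [Indist, perform, hr]
  · left; simp [perform, Function.update_comm h, Function.update_comm hr]

theorem Decided.step (h : P.Decided s v) (p : ι) : P.Decided (P.step s p) v := by
  obtain ⟨q, hq⟩ := h
  refine ⟨q, ?_⟩
  by_cases hqp : q = p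
  · subst hqp
    rwa [step_of_out_eq_some hq]
  · rwa [step_loc_of_ne hqp]

theorem Decided.run (h : P.Decided s v) (σ : List ι) : P.Decided (P.run s σ) v := by
  induction σ generalizing s with
  | nil => exact h
  | cons p _ ih => exact ih (h.step p)

theorem active_of_not_decided {σ : List ι} (h : ∀ v, ¬ P.Decided (P.run s σ) v) :
    P.Active s σ := by
  rintro τ p ⟨ρ, rfl⟩
  refine Option.eq_none_iff_forall_ne_some.2 fun v hv => h v ?_
  rw [List.append_assoc, run_append]
  exact Decided.run ⟨p, hv⟩ _

theorem active_concat {σ : List ι} :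
    P.Active s (σ ++ [p]) ↔ P.Active s σ ∧ P.out p ((P.run s σ).loc p) = none := by
  simp only [Active, List.prefix_concat_iff, or_imp, forall_and]
  rw [and_comm]
  simp

theorem exists_active_run_eq (s : SharedState ι Reg Val L) (σ : List ι) :
    ∃ τ ⊆ σ, P.Active s τ ∧ P.run s τ = P.run s σ := by
  induction σ using List.reverseRecOn with
  | nil => exact ⟨[], by simp, by simp [Active], rfl⟩
  | append_singleton σ p ih =>
    obtain ⟨τ, hsub, hact, hrun⟩ := ih
    rcases hout : P.out p ((P.run s σ).loc p) with _ | v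
    · refine ⟨τ ++ [p], ?_, active_concat.2 ⟨hact, hrun ▸ hout⟩, by simp only [run_concat, hrun]⟩
      exact List.append_subset.2 ⟨List.subset_append_of_subset_left _ hsub,
        List.subset_append_right _ _⟩
    · refine ⟨τ, List.subset_append_of_subset_left _ hsub, hact, ?_⟩
      rw [hrun, run_concat, step_of_out_eq_some hout]

theorem Agreement.run (h : P.Agreement s) (σ : List ι) : P.Agreement (P.run s σ) := by
  intro τ
  rw [← run_append]
  exact h _

theorem SoloDecides.of_step (h : P.SoloDecides p (P.step s p) v) : P.SoloDecides p s v :=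
  let ⟨n, hn⟩ := h
  ⟨n + 1, hn⟩

theorem Agreement.soloDecides_unique (h : P.Agreement s) (hv : P.SoloDecides p s v)
    (hw : P.SoloDecides p s w) : v = w := by
  obtain ⟨m, hm⟩ := hv
  obtain ⟨n, hn⟩ := hw
  refine h (List.replicate (m + n) p) v w ?_ ?_
  · rw [List.replicate_add, run_append]
    exact hm.run _
  · rw [add_comm, List.replicate_add, run_append]
    exact hn.run _

theorem Agreement.eq_of_indist (h : P.Agreement s)
    (hind : Indist q (P.step s q) (P.step (P.step s p) q))
    (hv : P.SoloDecides q (P.step s q) v) (hw : P.SoloDecides q (P.step s p) w) : v = w := by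
  refine (h.run [p]).soloDecides_unique ?_ hw
  obtain ⟨n, u, hu⟩ := hv
  by_cases huq : u = q
  · subst huq
    refine SoloDecides.of_step ⟨n, u, ?_⟩
    change P.out u ((P.run (P.step (P.step s p) u) _).loc u) = some v
    rwa [← (hind.run_replicate n).2]
  · rw [run_replicate_loc_of_ne huq, step_loc_of_ne huq] at hu
    exact ⟨0, Decided.step ⟨u, hu⟩ p⟩

theorem Agreement.soloAgree_of_extensions [Nonempty ι] (h : P.Agreement s)
    (hext : ∀ σ ≠ [], P.SoloAgree (P.run s σ)) : P.SoloAgree s := by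
  choose v hv using fun p => hext [p] (List.cons_ne_nil _ _)
  have heq (p q : ι) : v p = v q := by
    rcases eq_or_ne p q with rfl | hpq
    · rfl
    rcases step_comm_or_indist (P := P) s hpq with hcomm | hind | hind
    · obtain ⟨w, hw⟩ := hext [p, q] (List.cons_ne_nil _ _)
      have hp : v p = w := (h.run [p]).soloDecides_unique (hv p q) (hw q).of_step
      have hq : v q = w :=
        (h.run [q]).soloDecides_unique (hv q p) (SoloDecides.of_step (hcomm ▸ hw p))
      exact hp.trans hq.symm
    · exact (h.eq_of_indist hind (hv q q) (hv p q)).symm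
    · exact h.eq_of_indist hind (hv p p) (hv q p)
  obtain ⟨p⟩ := ‹Nonempty ι›
  exact ⟨v p, fun q => heq p q ▸ (hv q q).of_step⟩

theorem Agreement.exists_undecided_schedule [Nonempty ι] (h : P.Agreement s)
    (hs : ¬ P.SoloAgree s) (n : ℕ) :
    ∃ σ : List ι, σ.length = n ∧ ∀ v, ¬ P.Decided (P.run s σ) v := by
  have hlong : ∃ σ : List ι, n ≤ σ.length ∧ ¬ P.SoloAgree (P.run s σ) := by
    induction n with
    | zero => exact ⟨[], le_rfl, hs⟩
    | succ n ih =>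
      obtain ⟨σ, hlen, hσ⟩ := ih
      obtain ⟨τ, hne, hτ⟩ : ∃ τ ≠ [], ¬ P.SoloAgree (P.run (P.run s σ) τ) := by
        by_contra! hext
        exact hσ ((h.run σ).soloAgree_of_extensions hext)
      refine ⟨σ ++ τ, ?_, by rwa [run_append]⟩
      rw [List.length_append]
      exact add_le_add hlen (List.length_pos_of_ne_nil hne)
  obtain ⟨σ, hlen, hσ⟩ := hlong
  refine ⟨σ.take n, by simpa using hlen, fun v hv => hσ ⟨v, fun p => ⟨0, ?_⟩⟩⟩
  rw [← List.take_append_drop n σ, run_append]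
  exact hv.run _

end Protocol

end Protocol

section Linearizability

variable {Ω Reg Val : Type*} {E : List (Step Ω Reg Val)} {p : Fin 2} {b : Bool} {i : ℕ}

/-- The process that obtains `0` from the test-and-set object, given that the call of process `p`
has returned `b`. -/
def winner (p : Fin 2) (b : Bool) : Fin 2 :=
  if b then p.rev else p

theorem mem_of_mem_seqTAS_true {l : List (Fin 2)} (h : (p, b) ∈ seqTAS true l) :
    b = true ∧ p ∈ l := by
  induction l with
  | nil => cases h
  | cons q l ih =>
    rcases List.mem_cons.1 h with h | h
    · simp_all
    · exact (ih h).imp_right (List.mem_cons_of_mem _)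

theorem winner_eq_of_mem_seqTAS {x : Fin 2} {l : List (Fin 2)} (hl : (x :: l).Nodup)
    (h : (p, b) ∈ seqTAS false (x :: l)) : winner p b = x := by
  rcases List.mem_cons.1 h with h | h
  · cases h
    rfl
  · obtain ⟨rfl, hp⟩ := mem_of_mem_seqTAS_true h
    have hne : p ≠ x := fun hpx => (List.nodup_cons.1 hl).1 (hpx ▸ hp)
    exact (by decide : ∀ p x : Fin 2, p ≠ x → p.rev = x) p x hne

theorem Linearizable.exists_winner (hE : Linearizable E) (h : RespondsAt E p b i) :
    ∃ x, (∃ j, InvokedAt E x j) ∧ ∀ q b i, RespondsAt E q b i → winner q b = x := by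
  obtain ⟨l, hnodup, hinv, hresp, -⟩ := hE
  cases l with
  | nil => cases hresp p b i h
  | cons x l =>
    exact ⟨x, hinv x List.mem_cons_self, fun q b i hq =>
      winner_eq_of_mem_seqTAS hnodup (hresp q b i hq)⟩

theorem accessCount_append (p : Fin 2) (E E' : List (Step Ω Reg Val)) :
    accessCount p (E ++ E') = accessCount p E + accessCount p E' :=
  List.countP_append

end Linearizability

section Executions

variable {Ω Reg Val F O : Type*} [DecidableEq Reg]

namespace Algorithm

/-- The configuration at the end of the execution with schedule `σ` and coin flips `ω`. -/
def config (M : Algorithm Ω Reg Val F O) (ω : ℕ → Ω) (σ : List (Fin 2)) : Config Reg Val F O :=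
  σ.foldl (fun c p => (M.step ω c p).1) M.initConfig

variable {M : Algorithm Ω Reg Val F O} {ω : ℕ → Ω} {c : Config Reg Val F O}
  {σ τ : List (Fin 2)} {p q : Fin 2} {b : Bool}

theorem config_append :
    M.config ω (σ ++ τ) = τ.foldl (fun c p => (M.step ω c p).1) (M.config ω σ) :=
  List.foldl_append

theorem exec_append : M.exec (σ ++ τ) ω = M.exec σ ω ++ M.execFrom ω (M.config ω σ) τ := by
  unfold exec config
  generalize M.initConfig = c
  induction σ generalizing c with
  | nil => rfl
  | cons q σ ih => simp only [List.cons_append, execFrom, ih, List.foldl_cons]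

theorem step_pid : (M.step ω c p).2.pid = p := by
  unfold step
  split
  · rfl
  · split <;> rfl
  · rfl

theorem map_pid_exec : (M.exec σ ω).map Step.pid = σ := by
  induction σ using List.reverseRecOn with
  | nil => rfl
  | append_singleton σ p ih => simp [exec_append, execFrom, ih, step_pid]

theorem length_exec : (M.exec σ ω).length = σ.length := by
  rw [← List.length_map Step.pid, map_pid_exec]

theorem step_loc_of_ne (h : q ≠ p) : (M.step ω c p).1.loc q = c.loc q := by
  unfold step
  split
  · exact Function.update_of_ne h ..
  · split <;> exact Function.update_of_ne h ..
  · rfl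

theorem step_resp_of_finished (h : (M.step ω c p).1.loc p = .finished b)
    (hc : c.loc p ≠ .finished b) : (M.step ω c p).2.resp = some b := by
  unfold step at h ⊢
  split at h
  · simp_all [Local.result]
  · split at h <;> simp_all [Local.result]
  · exact absurd h hc

theorem exists_respondsAt_of_finished (h : (M.config ω σ).loc p = .finished b) :
    ∃ i, RespondsAt (M.exec σ ω) p b i := by
  induction σ using List.reverseRecOn with
  | nil => cases h
  | append_singleton σ q ih =>
    rw [exec_append]
    by_cases hold : (M.config ω σ).loc p = .finished b
    · obtain ⟨i, e, he, hpid, hresp⟩ := ih hold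
      refine ⟨i, e, ?_, hpid, hresp⟩
      rw [List.getElem?_append_left (List.getElem?_eq_some_iff.1 he).1, he]
    · rw [config_append] at h
      have hqp : p = q := by
        by_contra hne
        exact hold ((step_loc_of_ne hne).symm.trans h)
      subst hqp
      exact ⟨(M.exec σ ω).length, _, List.getElem?_concat_length, step_pid,
        step_resp_of_finished h hold⟩

theorem mem_of_invokedAt {i : ℕ} (h : InvokedAt (M.exec σ ω) p i) : p ∈ σ := by
  obtain ⟨⟨e, he, rfl⟩, -⟩ := h
  rw [← map_pid_exec (M := M) (σ := σ) (ω := ω)]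
  exact List.mem_map_of_mem (List.mem_of_getElem? he)

theorem IsTAS.winner_eq (hM : M.IsTAS) {b' : Bool} (hp : (M.config ω σ).loc p = .finished b)
    (hq : (M.config ω σ).loc q = .finished b') : winner p b = winner q b' := by
  obtain ⟨i, hi⟩ := exists_respondsAt_of_finished hp
  obtain ⟨j, hj⟩ := exists_respondsAt_of_finished hq
  obtain ⟨x, -, hx⟩ := (hM σ ω).exists_winner hi
  exact (hx p b i hi).trans (hx q b' j hj).symm

theorem IsTAS.winner_mem (hM : M.IsTAS) (hp : (M.config ω σ).loc p = .finished b) :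
    winner p b ∈ σ := by
  obtain ⟨i, hi⟩ := exists_respondsAt_of_finished hp
  obtain ⟨x, ⟨j, hj⟩, hx⟩ := (hM σ ω).exists_winner hi
  exact hx p b i hi ▸ mem_of_invokedAt hj

end Algorithm

end Executions

section Blocks

variable {Ω Reg Val F O : Type*}

/-- Postcomposition of the continuation of an access. -/
def Access.map {Next Next' : Type*} (g : Next → Next') : Access Reg Val Next → Access Reg Val Next'
  | .read r k => .read r (g ∘ k)
  | .write r v k => .write r v (g k)

/-- The schedule consisting of one block for each entry of `σ`, where a block consists of two
consecutive steps of the same process. -/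
def doubled (σ : List (Fin 2)) : List (Fin 2) :=
  σ.flatMap fun p => [p, p]

theorem doubled_concat (σ : List (Fin 2)) (p : Fin 2) :
    doubled (σ ++ [p]) = doubled σ ++ [p, p] := by
  simp [doubled]

theorem mem_doubled {σ : List (Fin 2)} {p : Fin 2} : p ∈ doubled σ ↔ p ∈ σ := by
  simp [doubled]

namespace Algorithm

variable {M : Algorithm Ω Reg Val F O} {a : Fin 2 × ℕ → Ω} {ω : ℕ → Ω} {c : Config Reg Val F O}
  {σ : List (Fin 2)} {p : Fin 2}

/-- The action of a block of process `p`: a coin flip, and the shared-memory access that follows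
unless the call has finished. The local state between blocks consists of the one of `M`, or
the return value, and the number `k` of blocks performed so far; the next coin flip returns
`a (p, k)`. -/
def blockAct (M : Algorithm Ω Reg Val F O) (a : Fin 2 × ℕ → Ω) (p : Fin 2) :
    (F ⊕ Bool) × ℕ → ((F ⊕ Bool) × ℕ) ⊕ Access Reg Val ((F ⊕ Bool) × ℕ)
  | (.inr b, k) => .inl (.inr b, k)
  | (.inl f, k) =>
    match M.flip p f (a (p, k)) with
    | .inr b => .inl (.inr b, k + 1)
    | .inl o => .inr ((M.access p o).map (·, k + 1))

/-- The deterministic protocol obtained from `M` by fixing the coin flips `a (p, ·)` of each process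
`p` and taking blocks as steps. A process that has returned decides on the winner. -/
def blockProtocol (M : Algorithm Ω Reg Val F O) (a : Fin 2 × ℕ → Ω) :
    Protocol (Fin 2) Reg Val ((F ⊕ Bool) × ℕ) (Fin 2) where
  act := M.blockAct a
  out p l := l.1.getRight?.map (winner p)
  act_of_out := by
    rintro p ⟨f | b, k⟩ v h
    · cases h
    · rfl

/-- The initial state of `M.blockProtocol a`. -/
def blockStart (M : Algorithm Ω Reg Val F O) : SharedState (Fin 2) Reg Val ((F ⊕ Bool) × ℕ) :=
  ⟨M.memInit, fun p => (.inl (M.start p), 0)⟩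

/-- The configuration `c` corresponds to the state `s` between two blocks. -/
structure Matches (c : Config Reg Val F O) (s : SharedState (Fin 2) Reg Val ((F ⊕ Bool) × ℕ)) :
    Prop where
  mem : c.mem = s.mem
  loc : ∀ p, c.loc p = .afterAccess (s.loc p).1

/-- The coin flips `ω`, consumed by the blocks scheduled by `σ`, are those that `a` prescribes for
each process. -/
def Interleaves (ω : ℕ → Ω) (a : Fin 2 × ℕ → Ω) (σ : List (Fin 2)) : Prop :=
  ∀ τ p, τ ++ [p] <+: σ → ω τ.length = a (p, τ.count p)

theorem blockProtocol_out_eq_none_iff {l : (F ⊕ Bool) × ℕ} :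
    (M.blockProtocol a).out p l = none ↔ ∃ f, l.1 = .inl f := by
  simp [blockProtocol, Sum.isLeft_iff]

theorem blockProtocol_out_eq_some_iff {l : (F ⊕ Bool) × ℕ} {v : Fin 2} :
    (M.blockProtocol a).out p l = some v ↔ ∃ b, l.1 = .inr b ∧ winner p b = v := by
  simp [blockProtocol]

variable {s : SharedState (Fin 2) Reg Val ((F ⊕ Bool) × ℕ)}

theorem Matches.exists_finished {v : Fin 2} (h : Matches c s)
    (hv : (M.blockProtocol a).Decided s v) : ∃ p b, c.loc p = .finished b ∧ winner p b = v := by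
  obtain ⟨p, hp⟩ := hv
  obtain ⟨b, hb, rfl⟩ := blockProtocol_out_eq_some_iff.1 hp
  exact ⟨p, b, by rw [h.loc, hb]; rfl, rfl⟩

theorem Matches.update (h : Matches c s) (mem : Reg → Val) (n : ℕ) (l : (F ⊕ Bool) × ℕ) :
    Matches ⟨mem, Function.update c.loc p (.afterAccess l.1), n⟩
      ⟨mem, Function.update s.loc p l⟩ where
  mem := rfl
  loc q := by
    rcases eq_or_ne q p with rfl | hq
    · simp
    · simp [hq, h.loc]

variable [DecidableEq Reg]

theorem Matches.block {f : F} (h : Matches c s) (hf : (s.loc p).1 = .inl f)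
    (hω : ω c.flips = a (p, (s.loc p).2)) :
    Matches (M.step ω (M.step ω c p).1 p).1 ((M.blockProtocol a).step s p) ∧
    (M.step ω (M.step ω c p).1 p).1.flips = c.flips + 1 ∧
    (((M.blockProtocol a).step s p).loc p).2 = (s.loc p).2 + 1 ∧
    ∀ f', (((M.blockProtocol a).step s p).loc p).1 = .inl f' →
      accessCount p [(M.step ω c p).2, (M.step ω (M.step ω c p).1 p).2] = 1 := by
  obtain ⟨mem, loc⟩ := s
  obtain ⟨k, hk⟩ : ∃ k, loc p = (.inl f, k) := ⟨_, Prod.ext hf rfl⟩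
  have hloc : c.loc p = .flipping f := by rw [h.loc, hf]; rfl
  have hmem : c.mem = mem := h.mem
  simp only [hk] at hω
  rcases hflip : M.flip p f (ω c.flips) with o | b
  · rcases hacc : M.access p o with ⟨r, g⟩ | ⟨r, v, g⟩
    · simpa [step, Protocol.step, Protocol.perform, blockProtocol, blockAct, hk, ← hω, hflip, hacc,
        hloc, Local.afterFlip, Access.map, accessCount, StepKind.isAccess, hmem] using
        h.update mem (c.flips + 1) (g (mem r), k + 1)
    · simpa [step, Protocol.step, Protocol.perform, blockProtocol, blockAct, hk, ← hω, hflip, hacc,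
        hloc, Local.afterFlip, Access.map, accessCount, StepKind.isAccess, hmem] using
        h.update (Function.update mem r v) (c.flips + 1) (g, k + 1)
  · simpa [step, Protocol.step, Protocol.perform, blockProtocol, blockAct, hk, ← hω, hflip, hloc,
      Local.afterFlip, Local.afterAccess, accessCount, StepKind.isAccess, hmem] using
      h.update mem (c.flips + 1) (.inr b, k + 1)

variable (M a ω σ) in
/-- After the blocks scheduled by `σ`, the execution of `M` with coin flips `ω` has reached the
configuration given by `M.blockProtocol a`, and in each of these blocks of an unfinished process
there was an access. -/
structure Simulates : Prop where
  matches_run : Matches (M.config ω (doubled σ)) ((M.blockProtocol a).run M.blockStart σ)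
  flips_eq : (M.config ω (doubled σ)).flips = σ.length
  blocks_eq : ∀ p, (((M.blockProtocol a).run M.blockStart σ).loc p).2 = σ.count p
  accessCount_eq : ∀ p f, (((M.blockProtocol a).run M.blockStart σ).loc p).1 = .inl f →
    accessCount p (M.exec (doubled σ) ω) = σ.count p

theorem Simulates.concat (h : Simulates M a ω σ)
    (hp : (M.blockProtocol a).out p (((M.blockProtocol a).run M.blockStart σ).loc p) = none)
    (hω : ω σ.length = a (p, σ.count p)) : Simulates M a ω (σ ++ [p]) := by
  obtain ⟨f, hf⟩ := blockProtocol_out_eq_none_iff.1 hp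
  rw [← h.flips_eq, ← h.blocks_eq] at hω
  obtain ⟨hmatch, hflips, hblocks, haccess⟩ := h.matches_run.block hf hω
  have hconfig : M.config ω (doubled (σ ++ [p])) =
      (M.step ω (M.step ω (M.config ω (doubled σ)) p).1 p).1 := by
    rw [doubled_concat, config_append]
    rfl
  have hexec : M.exec (doubled (σ ++ [p])) ω = M.exec (doubled σ) ω ++
      [(M.step ω (M.config ω (doubled σ)) p).2,
        (M.step ω (M.step ω (M.config ω (doubled σ)) p).1 p).2] := by
    rw [doubled_concat, exec_append]
    rfl
  refine ⟨?_, ?_, fun q => ?_, fun q f' hf' => ?_⟩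
  · rwa [hconfig, Protocol.run_concat]
  · rw [hconfig, hflips, h.flips_eq, List.length_append, List.length_singleton]
  · rw [Protocol.run_concat]
    rcases eq_or_ne q p with rfl | hq
    · simp [hblocks, h.blocks_eq]
    · simp [Protocol.step_loc_of_ne hq, h.blocks_eq, hq.symm]
  · rw [Protocol.run_concat] at hf'
    rw [hexec, accessCount_append]
    rcases eq_or_ne q p with rfl | hq
    · simp [haccess f' hf', h.accessCount_eq q f hf]
    · rw [Protocol.step_loc_of_ne hq] at hf'
      simp [accessCount, step_pid, hq.symm, ← h.accessCount_eq q f' hf']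

theorem simulates_of_active (hσ : (M.blockProtocol a).Active M.blockStart σ)
    (hω : Interleaves ω a σ) : Simulates M a ω σ := by
  induction σ using List.reverseRecOn with
  | nil => exact ⟨⟨rfl, fun _ => rfl⟩, rfl, fun _ => rfl, fun _ _ _ => rfl⟩
  | append_singleton σ p ih =>
    obtain ⟨hσ, hp⟩ := Protocol.active_concat.1 hσ
    exact (ih hσ fun τ q hτ => hω τ q (hτ.trans (List.prefix_append ..))).concat hp
      (hω σ p List.prefix_rfl)

end Algorithm

end Blocks

section FlipIndex

variable {ι : Type*} [DecidableEq ι] {b : ℕ → ι} {p : ι}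

/-- If the `i`-th coin flip among all processes is made by process `b i` for each `i`, then the
coin flip with global index `i` is flip number `(flipIndex b i).2` of process `(flipIndex b i).1`,
counted from `0`. -/
def flipIndex (b : ℕ → ι) (i : ℕ) : ι × ℕ :=
  (b i, Nat.count (fun j => b j = b i) i)

theorem flipIndex_injective (b : ℕ → ι) : Function.Injective (flipIndex b) := by
  intro i j h
  obtain ⟨hb, hcount⟩ := Prod.ext_iff.1 h
  simp only [flipIndex] at hb hcount
  rw [← hb] at hcount
  exact Nat.count_injective (p := fun k => b k = b i) rfl hb.symm hcount

theorem count_getD_append (τ ρ : List ι) (p d : ι) :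
    Nat.count (fun j => (τ ++ ρ).getD j d = p) τ.length = τ.count p := by
  induction τ using List.reverseRecOn generalizing ρ with
  | nil => rfl
  | append_singleton τ q ih =>
    simp only [List.append_assoc, List.length_append, List.length_singleton, Nat.count_succ, ih,
      List.count_append, List.count_singleton]
    simp

theorem flipIndex_getD {σ τ : List ι} (h : τ ++ [p] <+: σ) (d : ι) :
    flipIndex (σ.getD · d) τ.length = (p, τ.count p) := by
  obtain ⟨ρ, rfl⟩ := h
  have hp : (τ ++ [p] ++ ρ).getD τ.length d = p := by simp
  simp only [flipIndex, hp]
  rw [List.append_assoc, count_getD_append]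

end FlipIndex

section Adversary

variable {Ω Reg Val F O : Type*}

/-- The oblivious adversary that schedules one block for each entry of `σ`, and only process `0`
afterwards. -/
def blockAdversary (σ : List (Fin 2)) : Adversary Ω Reg Val :=
  fun E => σ.getD (E.length / 2) 0

theorem blockAdversary_isOblivious (σ : List (Fin 2)) :
    (blockAdversary σ : Adversary Ω Reg Val).IsOblivious :=
  fun _ _ h => congrArg (fun n => σ.getD (n / 2) 0) h

namespace Algorithm

variable [DecidableEq Reg] {M : Algorithm Ω Reg Val F O} {a : Fin 2 × ℕ → Ω} {ω : ℕ → Ω}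
  {σ : List (Fin 2)}

theorem sched_blockAdversary {τ : List (Fin 2)} (h : τ <+: σ) :
    M.sched (blockAdversary σ) ω (2 * τ.length) = doubled τ := by
  induction τ using List.reverseRecOn with
  | nil => rfl
  | append_singleton τ p ih =>
    have hlen : (doubled τ).length = 2 * τ.length := by
      simp [doubled, mul_comm]
    have hnext (E : List (Step Ω Reg Val)) (hE : E.length / 2 = τ.length) :
        blockAdversary σ E = p := by
      obtain ⟨ρ, rfl⟩ := h
      simp [blockAdversary, hE]
    rw [List.length_append, List.length_singleton, mul_add, mul_one, doubled_concat, sched, sched,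
      ih ((List.prefix_append ..).trans h), hnext _ (by simp [length_exec, hlen]),
      hnext _ (by simp [length_exec, hlen]; lia), List.append_assoc]
    rfl

theorem accessCount_le_maxStep (p : Fin 2) :
    (accessCount p (M.exec (doubled σ) ω) : ℕ∞) ≤ M.maxStep (blockAdversary σ) ω := by
  rw [← sched_blockAdversary (M := M) (ω := ω) (List.prefix_rfl (l := σ))]
  exact le_iSup₂_of_le (f := fun p n =>
    (accessCount p (M.exec (M.sched (blockAdversary σ) ω n) ω) : ℕ∞)) p _ le_rfl

end Algorithm

end Adversary

section LowerBound

variable {Ω Reg Val F O : Type*} [DecidableEq Reg]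

namespace Algorithm

variable {M : Algorithm Ω Reg Val F O} {a : Fin 2 × ℕ → Ω} {ω : ℕ → Ω}
  {σ : List (Fin 2)} {v : Fin 2}

theorem interleaves_flipIndex (a : Fin 2 × ℕ → Ω) {σ τ : List (Fin 2)} (h : τ <+: σ) :
    Interleaves (a ∘ flipIndex (σ.getD · 0)) a τ :=
  fun _ _ hτ => congrArg a (flipIndex_getD (hτ.trans h) 0)

variable (M a σ) in
theorem exists_matches_run :
    ∃ ω, ∃ τ ⊆ σ, Matches (M.config ω (doubled τ)) ((M.blockProtocol a).run M.blockStart σ) := by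
  obtain ⟨τ, hsub, hact, hrun⟩ := (M.blockProtocol a).exists_active_run_eq M.blockStart σ
  have hsim := simulates_of_active hact (interleaves_flipIndex a List.prefix_rfl)
  exact ⟨_, τ, hsub, hrun ▸ hsim.matches_run⟩

theorem IsTAS.blockProtocol_agreement (hM : M.IsTAS) (a : Fin 2 × ℕ → Ω) :
    (M.blockProtocol a).Agreement M.blockStart := by
  intro σ v w hv hw
  obtain ⟨ω, τ, -, h⟩ := exists_matches_run M a σ
  obtain ⟨p, b, hp, rfl⟩ := h.exists_finished hv
  obtain ⟨q, b', hq, rfl⟩ := h.exists_finished hw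
  exact hM.winner_eq hp hq

theorem IsTAS.mem_of_decided (hM : M.IsTAS)
    (hv : (M.blockProtocol a).Decided ((M.blockProtocol a).run M.blockStart σ) v) : v ∈ σ := by
  obtain ⟨ω, τ, hsub, h⟩ := exists_matches_run M a σ
  obtain ⟨p, b, hp, rfl⟩ := h.exists_finished hv
  exact hsub (mem_doubled.1 (hM.winner_mem hp))

theorem IsTAS.not_soloAgree (hM : M.IsTAS) (a : Fin 2 × ℕ → Ω) :
    ¬ (M.blockProtocol a).SoloAgree M.blockStart := by
  rintro ⟨v, hv⟩
  have heq (p : Fin 2) : v = p := by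
    obtain ⟨n, hn⟩ := hv p
    exact List.eq_of_mem_replicate (hM.mem_of_decided hn)
  exact zero_ne_one ((heq 0).symm.trans (heq 1))

theorem Simulates.exists_accessCount_ge (h : Simulates M a ω σ)
    (hσ : ∀ v, ¬ (M.blockProtocol a).Decided ((M.blockProtocol a).run M.blockStart σ) v)
    {t : ℕ} (ht : σ.length = 2 * t) : ∃ p, t ≤ accessCount p (M.exec (doubled σ) ω) := by
  have hcount (p : Fin 2) : accessCount p (M.exec (doubled σ) ω) = σ.count p := by
    obtain ⟨f, hf⟩ := blockProtocol_out_eq_none_iff.1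
      (Option.eq_none_iff_forall_ne_some.2 fun v hv => hσ v ⟨p, hv⟩)
    exact h.accessCount_eq p f hf
  have hsum : ∑ p, σ.count p = ∑ _p : Fin 2, t := by
    rw [Finset.sum_const, Finset.card_univ, Fintype.card_fin, smul_eq_mul, ← ht]
    simpa using Multiset.sum_count_eq_card (m := (σ : Multiset (Fin 2)))
      fun p _ => Finset.mem_univ p
  obtain ⟨p, -, hp⟩ := Finset.exists_le_of_sum_le Finset.univ_nonempty hsum.ge
  exact ⟨p, hcount p ▸ hp⟩

theorem IsTAS.exists_le_maxStep (hM : M.IsTAS) (a : Fin 2 × ℕ → Ω) (t : ℕ) :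
    ∃ σ : List (Fin 2), σ.length = 2 * t ∧
      t ≤ M.maxStep (blockAdversary σ) (a ∘ flipIndex (σ.getD · 0)) := by
  obtain ⟨σ, hlen, hσ⟩ :=
    (hM.blockProtocol_agreement a).exists_undecided_schedule (hM.not_soloAgree a) (2 * t)
  refine ⟨σ, hlen, ?_⟩
  have hsim := simulates_of_active (Protocol.active_of_not_decided hσ)
    (interleaves_flipIndex a List.prefix_rfl)
  obtain ⟨p, hp⟩ := hsim.exists_accessCount_ge hσ hlen
  exact (Nat.cast_le.2 hp).trans (accessCount_le_maxStep p)

end Algorithm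

end LowerBound

section Pigeonhole

theorem exists_inv_card_le_infinitePi {ι α κ Ω : Type*} [Fintype ι] [MeasurableSpace Ω]
    (D : Measure Ω) [IsProbabilityMeasure D] {g : ι → α → κ} (hg : ∀ i, Function.Injective (g i))
    {G : ι → Set (α → Ω)} (hG : ∀ a : κ → Ω, ∃ i, a ∘ g i ∈ G i) :
    ∃ i, (Fintype.card ι : ℝ≥0∞)⁻¹ ≤ Measure.infinitePi (fun _ => D) (G i) := by
  obtain ⟨x⟩ := nonempty_of_isProbabilityMeasure D
  obtain ⟨i₀, -⟩ := hG fun _ => x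
  have hle (i : ι) : Measure.infinitePi (fun _ => D) ((fun a => a ∘ g i) ⁻¹' G i) ≤
      Measure.infinitePi (fun _ => D) (G i) := by
    rw [← Measure.map_infinitePi_infinitePi_of_inj (P := fun _ => D) (hg i)]
    exact Measure.le_map_apply
      (measurable_pi_lambda _ fun _ => measurable_pi_apply _).aemeasurable _
  have hcover : ⋃ i, (fun a => a ∘ g i) ⁻¹' G i = Set.univ :=
    Set.eq_univ_of_forall fun a => Set.mem_iUnion.2 (hG a)
  have hsum : ∑ _i : ι, (Fintype.card ι : ℝ≥0∞)⁻¹ ≤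
      ∑ i, Measure.infinitePi (fun _ => D) (G i) :=
    calc ∑ _i : ι, (Fintype.card ι : ℝ≥0∞)⁻¹ ≤ 1 := by
          rw [Finset.sum_const, Finset.card_univ, nsmul_eq_mul]
          exact ENNReal.mul_inv_le_one _
      _ = Measure.infinitePi (fun _ => D) (⋃ i, (fun a => a ∘ g i) ⁻¹' G i) := by
          rw [hcover, measure_univ]
      _ ≤ ∑ i, Measure.infinitePi (fun _ => D) ((fun a => a ∘ g i) ⁻¹' G i) :=
          measure_iUnion_fintype_le _ _
      _ ≤ ∑ i, Measure.infinitePi (fun _ => D) (G i) := Finset.sum_le_sum fun i _ => hle i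
  obtain ⟨i, -, hi⟩ := ENNReal.exists_le_of_sum_le ⟨i₀, Finset.mem_univ i₀⟩ hsum
  exact ⟨i, hi⟩

end Pigeonhole

end TwoProcessTAS

theorem theorem6p1_general {Ω Reg Val F O : Type*} [DecidableEq Reg] [MeasurableSpace Ω]
    (D : Measure Ω) [IsProbabilityMeasure D]
    (M : TwoProcessTAS.Algorithm Ω Reg Val F O) (hM : M.IsTAS) (t : ℕ) :
    ∃ A : TwoProcessTAS.Adversary Ω Reg Val, A.IsOblivious ∧
      (1 / 4 ^ t : ℝ≥0∞) ≤
        Measure.infinitePi (fun _ : ℕ => D) {ω : ℕ → Ω | (t : ℕ∞) ≤ M.maxStep A ω} := by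
  obtain ⟨σ, hσ⟩ := TwoProcessTAS.exists_inv_card_le_infinitePi (ι := List.Vector (Fin 2) (2 * t)) D
    (g := fun σ => TwoProcessTAS.flipIndex (σ.toList.getD · 0))
    (G := fun σ => {ω | (t : ℕ∞) ≤ M.maxStep (TwoProcessTAS.blockAdversary σ.toList) ω})
    (fun _ => TwoProcessTAS.flipIndex_injective _) fun a => by
      obtain ⟨σ, hlen, hσ⟩ := hM.exists_le_maxStep a t
      exact ⟨⟨σ, hlen⟩, hσ⟩
  refine ⟨_, TwoProcessTAS.blockAdversary_isOblivious σ.toList, le_of_eq_of_le ?_ hσ⟩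
  rw [card_vector, Fintype.card_fin, pow_mul, one_div]
  norm_num

theorem theorem6p1 {Ω Reg Val F O : Type*} [DecidableEq Reg]
    [Countable Ω] [MeasurableSpace Ω] [DiscreteMeasurableSpace Ω]
    (D : Measure Ω) [IsProbabilityMeasure D]
    (M : TwoProcessTAS.Algorithm Ω Reg Val F O) (hM : M.IsTAS) (t : ℕ) :
    ∃ A : TwoProcessTAS.Adversary Ω Reg Val, A.IsOblivious ∧
      (1 / 4 ^ t : ℝ≥0∞) ≤
        Measure.infinitePi (fun _ : ℕ => D) {ω : ℕ → Ω | (t : ℕ∞) ≤ M.maxStep A ω} :=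
  theorem6p1_general D M hM t
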